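/- Let $n\ge 5$ be an odd integer and let $\mathbb{S}^n$ be the unit sphere of $\mathbb{R}^{n+1}$. Then there exist a real number $a>0$ and a full Riemannian immersion $$\phi:\ T^2=\mathbb{R}^2/\Lambda_a\longrightarrow\mathbb{S}^n,\qquad \Lambda_a=\{(2\pi ka,2\pi la):k,l\in\mathbb{Z}\},$$ of the flat square torus $T^2$ which has constant mean curvature and is proper-biharmonic. Here $\phi$ is a Riemannian immersion if it is smooth and $d\phi$ preserves inner products; it is full if its image lies in no totally geodesic sphere $\mathbb{S}^{n'}\subset\mathbb{S}^n$ with $n'<n$ (equivalently, in no proper linear subspace of $\mathbb{R}^{n+1}$); it has constant mean curvature if $|H|$ is constant, where $H=\tfrac12\operatorname{trace}B$ and $B$ is the second fundamental form of $\phi$ in $\mathbb{S}^n$. With the tension field $\tau(\phi)=\operatorname{trace}\nabla d\phi$, the map $\phi$ is harmonic if $\tau(\phi)=0$; it is biharmonic if it is a critical point of the bienergy $E_2(\phi)=\tfrac12\int_{T^2}|\tau(\phi)|^2\,v_g$, i.e. $\frac{d}{dt}\big|_{t=0}E_2(\phi_t)=0$ for every smooth variation $(\phi_t)_{t\in\mathbb{R}}$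 of $\phi=\phi_0$ by maps $T^2\to\mathbb{S}^n$; and it is proper-biharmonic if it is biharmonic but not harmonic. -/

import Mathlib

open scoped ContDiff

noncomputable section

namespace SquareTorusImmersion

/-- The Euclidean plane. -/
abbrev Plane : Type := EuclideanSpace ℝ (Fin 2)

/-- The Euclidean space `ℝ^{n+1}`. -/
abbrev Ambient (n : ℕ) : Type := EuclideanSpace ℝ (Fin (n + 1))

/-- The unit sphere `S^n` in `ℝ^{n+1}`. -/
abbrev UnitSphere (n : ℕ) : Type := Metric.sphere (0 : Ambient n) 1

/-- The square lattice `{(2πka, 2πla) : k, l ∈ ℤ}` in the plane. -/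
def squareLattice (a : ℝ) : AddSubgroup Plane where
  carrier := {z | ∃ k : Fin 2 → ℤ, ∀ i, z i = 2 * Real.pi * a * (k i : ℝ)}
  zero_mem' := ⟨0, fun i => by simp⟩
  add_mem' := by
    rintro x y ⟨k, hk⟩ ⟨l, hl⟩
    exact ⟨k + l, fun i => by simp [hk i, hl i, mul_add]⟩
  neg_mem' := by
    rintro x ⟨k, hk⟩
    exact ⟨-k, fun i => by simp [hk i]⟩

/-- The square torus `ℝ² / {(2πka, 2πla) : k, l ∈ ℤ}`. Its smooth structure and flat metric are the
ones for which the projection from the plane is a local isometry (when `a ≠ 0`), so local notions on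
the torus are expressed below through lifts to the plane. -/
abbrev SquareTorus (a : ℝ) : Type := Plane ⧸ squareLattice a

variable {a : ℝ} {n : ℕ}

/-- The lift to the plane of a map from the torus to the sphere, seen as a map into `ℝ^{n+1}`. -/
def lift (φ : SquareTorus a → UnitSphere n) : Plane → Ambient n :=
  fun z => (φ (QuotientAddGroup.mk z) : Ambient n)

/-- Smoothness of a map from the torus to the sphere. -/
def IsSmoothMap (φ : SquareTorus a → UnitSphere n) : Prop :=
  ContDiff ℝ ∞ (lift φ)

/-- `φ` is a Riemannian (isometric) immersion: it is smooth and its differential preserves the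
inner products of tangent vectors. -/
def IsRiemannianImmersion (φ : SquareTorus a → UnitSphere n) : Prop :=
  IsSmoothMap φ ∧
    ∀ z u v : Plane, inner ℝ (fderiv ℝ (lift φ) z u) (fderiv ℝ (lift φ) z v) = inner ℝ u v

/-- `φ` is full: its image lies in no totally geodesic sphere `S^{n'} ⊂ S^n` with `n' < n`, that is,
in no proper linear subspace of `ℝ^{n+1}`. -/
def IsFull (φ : SquareTorus a → UnitSphere n) : Prop :=
  ∀ W : Submodule ℝ (Ambient n), (∀ x, (φ x : Ambient n) ∈ W) → W = ⊤

/-- The connection of the pull-back bundle `φ⁻¹ T S^n`: the derivative in the direction `u` of the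
section `V` along `φ`, projected to the tangent space of the sphere at the point `φ(z)`. -/
def covDeriv (φ : SquareTorus a → UnitSphere n) (V : Plane → Ambient n) (z u : Plane) : Ambient n :=
  fderiv ℝ V z u - inner ℝ (fderiv ℝ V z u) (lift φ z) • lift φ z

/-- The Hessian `(∇dφ)(u, v) = ∇_u (dφ(v)) - dφ(∇_u v)` at `z`; the second term vanishes as the
metric of the torus is flat and `v` is extended to a constant vector field. -/
def hessian (φ : SquareTorus a → UnitSphere n) (z u v : Plane) : Ambient n :=
  covDeriv φ (fun w => fderiv ℝ (lift φ) w v) z u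

/-- The standard orthonormal basis of the plane. -/
def stdVec (i : Fin 2) : Plane := EuclideanSpace.single i (1 : ℝ)

/-- The tension field `τ(φ) = trace ∇dφ`. -/
def tension (φ : SquareTorus a → UnitSphere n) (z : Plane) : Ambient n :=
  ∑ i, hessian φ z (stdVec i) (stdVec i)

/-- `φ` is harmonic: its tension field vanishes. -/
def IsHarmonicMap (φ : SquareTorus a → UnitSphere n) : Prop :=
  ∀ z, tension φ z = 0

/-- The fundamental domain `[0, 2πa)²` of the square lattice. -/
def fundamentalSquare (a : ℝ) : Set Plane :=
  {z | ∀ i, z i ∈ Set.Ico 0 (2 * Real.pi * a)}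

/-- The bienergy `E₂(φ) = (1/2) ∫_{T²} |τ(φ)|² v_g`. -/
def bienergy (φ : SquareTorus a → UnitSphere n) : ℝ :=
  (1 / 2) * ∫ z in fundamentalSquare a, ‖tension φ z‖ ^ 2

/-- A smooth variation of `φ`: a smooth one-parameter family of maps from the torus to the sphere
that equals `φ` at time `0`. -/
def IsSmoothVariation (φ : SquareTorus a → UnitSphere n)
    (Φ : ℝ → SquareTorus a → UnitSphere n) : Prop :=
  ContDiff ℝ ∞ (fun p : ℝ × Plane => lift (Φ p.1) p.2) ∧ Φ 0 = φ

/-- `φ` is biharmonic: it is a smooth critical point of the bienergy functional. -/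
def IsBiharmonicMap (φ : SquareTorus a → UnitSphere n) : Prop :=
  IsSmoothMap φ ∧ ∀ Φ : ℝ → SquareTorus a → UnitSphere n, IsSmoothVariation φ Φ →
    HasDerivAt (fun t => bienergy (Φ t)) 0 0

/-- `φ` is proper-biharmonic: biharmonic and not harmonic. -/
def IsProperBiharmonic (φ : SquareTorus a → UnitSphere n) : Prop :=
  IsBiharmonicMap φ ∧ ¬ IsHarmonicMap φ

/-- The tangent plane `dφ(T_z T²)`, as a subspace of `ℝ^{n+1}`. -/
def tangentPlane (φ : SquareTorus a → UnitSphere n) (z : Plane) : Submodule ℝ (Ambient n) :=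
  LinearMap.range (fderiv ℝ (lift φ) z).toLinearMap

/-- The second fundamental form of `φ` in the sphere: the component of `∇_u (dφ(v))`
normal to the surface. -/
def secondFundamentalForm (φ : SquareTorus a → UnitSphere n) (z u v : Plane) : Ambient n :=
  (tangentPlane φ z)ᗮ.starProjection (hessian φ z u v)

/-- The mean curvature vector `H = (1/2) trace B` of a Riemannian immersion of the torus, where `B`
is the second fundamental form. -/
def meanCurvatureVector (φ : SquareTorus a → UnitSphere n) (z : Plane) : Ambient n :=
  (1 / 2 : ℝ) • ∑ i, secondFundamentalForm φ z (stdVec i) (stdVec i)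

/-- `φ` has constant mean curvature: `|H|` is constant. -/
def IsCMC (φ : SquareTorus a → UnitSphere n) : Prop :=
  ∃ h : ℝ, ∀ z, ‖meanCurvatureVector φ z‖ = h

end SquareTorusImmersion

end

/-! The immersion is a sum of plane waves: its k-th pair of coordinates is `√(w k)` times the cosine
and sine of `⟨f k, z⟩`. Every geometric condition becomes algebra in the weights and frequencies.
The image lies on the sphere when `∑ w = 1`. The map is isometric when `∑ w • f ⊗ f` is the
identity. It descends to the torus when `a • f k` is integral, and it is full when the `±f k` are
pairwise distinct, by linear independence of characters. The first variation of the bienergy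
(`isBiharmonicMap_of_laplacian`) reduces biharmonicity to `Δ²F + 4ΔF ∈ ℝ F`. For plane waves this
says that `X² - 4X` takes the same value at all `X = ‖f k‖²`, so the frequencies may lie on two
circles whose squared radii add up to 4. Unequal radii exclude harmonicity. There remains an
arithmetic problem: `exists_rational_frequencies` finds rational points on two circles, half of the
weight on each, with isotropic second moments. Pythagorean points fill one circle, and a mirror pair
on a larger circle corrects the anisotropy. Rescaling normalises the metric, and a common
denominator fixes `a`. -/

open scoped ContDiff

noncomputable section

namespace SquareTorusImmersion

/-! ### Calculus on the flat torus: divergence theorem, Green's identity, parameter integrals -/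

section Calculus

open MeasureTheory Set

variable {E : Type*} [NormedAddCommGroup E] [NormedSpace ℝ E]

/-- The Laplacian of a vector-valued function on the plane. -/
def laplacian (G : Plane → E) (z : Plane) : E :=
  ∑ i, fderiv ℝ (fun w => fderiv ℝ G w (stdVec i)) z (stdVec i)

/-- The metric is flat, so only the projection to the tangent space of the sphere separates the
tension field from the Laplacian of the lift. -/
theorem tension_eq_laplacian_sub {a : ℝ} {n : ℕ} (φ : SquareTorus a → UnitSphere n) (z : Plane) :
    tension φ z = laplacian (lift φ) z - inner ℝ (laplacian (lift φ) z) (lift φ z) • lift φ z := by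
  simp only [tension, hessian, covDeriv, laplacian, Finset.sum_sub_distrib, sum_inner,
    Finset.sum_smul]

theorem contDiff_fderiv_apply_const {X : Type*} [NormedAddCommGroup X] [NormedSpace ℝ X]
    {G : X → E} (hG : ContDiff ℝ ∞ G) (u : X) : ContDiff ℝ ∞ fun w => fderiv ℝ G w u :=
  (hG.fderiv_right (m := ∞) (by simp)).clm_apply contDiff_const

theorem fderiv_fderiv_apply_comm {X : Type*} [NormedAddCommGroup X] [NormedSpace ℝ X]
    {G : X → E} (hG : ContDiff ℝ ∞ G) (u v x : X) :
    fderiv ℝ (fun w => fderiv ℝ G w u) x v = fderiv ℝ (fun w => fderiv ℝ G w v) x u := by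
  have hd : DifferentiableAt ℝ (fderiv ℝ G) x :=
    ((hG.fderiv_right (m := ∞) (by simp)).differentiable (by simp)) x
  have hs : IsSymmSndFDerivAt ℝ G x := hG.contDiffAt.isSymmSndFDerivAt (by
    rw [minSmoothness_of_isRCLikeNormedField]; exact WithTop.coe_le_coe.2 le_top)
  rw [fderiv_clm_apply hd (differentiableAt_const _), fderiv_clm_apply hd (differentiableAt_const _)]
  simpa using hs.eq v u

theorem contDiff_laplacian {G : Plane → E} (hG : ContDiff ℝ ∞ G) :
    ContDiff ℝ ∞ (laplacian G) :=
  ContDiff.sum fun _ _ => contDiff_fderiv_apply_const (contDiff_fderiv_apply_const hG _) _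

theorem measurableSet_fundamentalSquare (a : ℝ) : MeasurableSet (fundamentalSquare a) := by
  have : fundamentalSquare a = ⋂ i, (fun z : Plane => z i) ⁻¹' Ico 0 (2 * Real.pi * a) := by
    ext z; simp [fundamentalSquare]
  rw [this]
  exact MeasurableSet.iInter fun i => measurableSet_Ico.preimage (by fun_prop)

/-- The closure of the fundamental square. -/
def closedSquare (a : ℝ) : Set Plane :=
  (PiLp.continuousLinearEquiv 2 ℝ fun _ : Fin 2 => ℝ) ⁻¹' Icc 0 (fun _ => 2 * Real.pi * a)

theorem isCompact_closedSquare (a : ℝ) : IsCompact (closedSquare a) :=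
  (PiLp.continuousLinearEquiv 2 ℝ fun _ : Fin 2 => ℝ).toHomeomorph.isCompact_preimage.2
    isCompact_Icc

theorem fundamentalSquare_subset_closedSquare (a : ℝ) :
    fundamentalSquare a ⊆ closedSquare a := fun _ hz =>
  ⟨fun i => (hz i).1, fun i => (hz i).2.le⟩

theorem _root_.Continuous.integrableOn_fundamentalSquare {F : Type*} [NormedAddCommGroup F]
    {g : Plane → F} (hg : Continuous g) (a : ℝ) :
    IntegrableOn g (fundamentalSquare a) :=
  (hg.continuousOn.integrableOn_compact (isCompact_closedSquare a)).mono_set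
    (fundamentalSquare_subset_closedSquare a)

/-- The integral over the torus of the divergence of a periodic vector field vanishes. -/
theorem integral_divergence_fundamentalSquare_eq_zero {a : ℝ} (ha : 0 < a) (X : Fin 2 → Plane → ℝ)
    (hX : ∀ i, ContDiff ℝ 1 (X i))
    (hper : ∀ i z, X i (z + (2 * Real.pi * a) • stdVec i) = X i z) :
    ∫ z in fundamentalSquare a, ∑ i, fderiv ℝ (X i) z (stdVec i) = 0 := by
  set eL := PiLp.continuousLinearEquiv 2 ℝ fun _ : Fin 2 => ℝ
  have hb : (0 : Fin 2 → ℝ) ≤ fun _ => 2 * Real.pi * a := fun i => by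
    have := Real.pi_pos; simp only [Pi.zero_apply]; positivity
  have hvol : MeasurePreserving eL volume volume := PiLp.volume_preserving_ofLp (Fin 2)
  have hemb : MeasurableEmbedding eL := eL.toHomeomorph.measurableEmbedding
  have hsq : fundamentalSquare a = eL ⁻¹' (pi univ fun _ => Ico 0 (2 * Real.pi * a)) := by
    ext z; simp [fundamentalSquare, eL]
  have hfd : Continuous fun z => ∑ i, fderiv ℝ (X i) z (stdVec i) :=
    continuous_finsetSum _ fun i _ =>
      ((hX i).continuous_fderiv (by simp)).clm_apply continuous_const
  have key := integral_divergence_of_hasFDerivAt_off_countable' (0 : Fin 2 → ℝ)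
    (fun _ => 2 * Real.pi * a) hb (fun i x => X i (eL.symm x))
    (fun i x => fderiv ℝ (X i) (eL.symm x) ∘L (eL.symm : (Fin 2 → ℝ) →L[ℝ] Plane)) ∅
    countable_empty (fun i => ((hX i).continuous.comp eL.symm.continuous).continuousOn)
    (fun x _ i => (((hX i).differentiable (by simp)) (eL.symm x)).hasFDerivAt.comp x
      eL.symm.hasFDerivAt)
    (by
      apply ContinuousOn.integrableOn_compact isCompact_Icc
      exact (hfd.comp eL.symm.continuous).continuousOn)
  calc
    ∫ z in fundamentalSquare a, ∑ i, fderiv ℝ (X i) z (stdVec i)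
      = ∫ x in pi univ fun _ => Ico 0 (2 * Real.pi * a),
          ∑ i, fderiv ℝ (X i) (eL.symm x) (stdVec i) := by
        rw [hsq, ← hvol.setIntegral_preimage_emb hemb]
        simp
    _ = ∫ x in Icc (0 : Fin 2 → ℝ) (fun _ => 2 * Real.pi * a),
          ∑ i, fderiv ℝ (X i) (eL.symm x) (stdVec i) :=
        setIntegral_congr_set Measure.univ_pi_Ico_ae_eq_Icc
    _ = 0 := by
        -- Opposite faces of the square differ by one period, so their fluxes cancel.
        refine key.trans (Finset.sum_eq_zero fun i _ => ?_)
        rw [sub_eq_zero]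
        congr 1
        ext x
        refine Eq.trans ?_ (hper i _)
        congr 1
        ext j
        rcases Fin.eq_self_or_eq_succAbove i j with rfl | ⟨k, rfl⟩
        · simp [eL, stdVec]
        · simp [eL, stdVec]

theorem fderiv_add_period {G : Plane → E} {c : Plane} (h : ∀ z, G (z + c) = G z) (z : Plane) :
    fderiv ℝ G (z + c) = fderiv ℝ G z := by
  rw [← fderiv_comp_add_right]
  simp only [h]

variable {H : Type*} [NormedAddCommGroup H] [InnerProductSpace ℝ H]

/-- Green's identity on the torus. -/
theorem integral_inner_laplacian_sub_eq_zero {a : ℝ} (ha : 0 < a) {V G : Plane → H}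
    (hV : ContDiff ℝ ∞ V) (hG : ContDiff ℝ ∞ G)
    (hVper : ∀ i z, V (z + (2 * Real.pi * a) • stdVec i) = V z)
    (hGper : ∀ i z, G (z + (2 * Real.pi * a) • stdVec i) = G z) :
    ∫ z in fundamentalSquare a,
      (inner ℝ (laplacian V z) (G z) - inner ℝ (V z) (laplacian G z)) = 0 := by
  have hV' := fun i : Fin 2 => contDiff_fderiv_apply_const hV (stdVec i)
  have hG' := fun i : Fin 2 => contDiff_fderiv_apply_const hG (stdVec i)
  have hX : ∀ i : Fin 2, ContDiff ℝ ∞ fun z =>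
      inner ℝ (fderiv ℝ V z (stdVec i)) (G z) - inner ℝ (V z) (fderiv ℝ G z (stdVec i)) :=
    fun i => ((hV' i).inner ℝ hG).sub (hV.inner ℝ (hG' i))
  rw [← integral_divergence_fundamentalSquare_eq_zero ha
    (fun i z => inner ℝ (fderiv ℝ V z (stdVec i)) (G z) - inner ℝ (V z) (fderiv ℝ G z (stdVec i)))
    (fun i => (hX i).of_le (by simp))
    (fun i z => by
      simp only [fderiv_add_period (hVper i), fderiv_add_period (hGper i), hVper, hGper])]
  congr 1
  ext z
  simp only [laplacian, sum_inner, inner_sum, ← Finset.sum_sub_distrib]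
  refine Finset.sum_congr rfl fun i _ => ?_
  have d1 := (hV.differentiable (by simp)) z
  have d2 := (hG.differentiable (by simp)) z
  have d3 := ((hV' i).differentiable (by simp)) z
  have d4 := ((hG' i).differentiable (by simp)) z
  rw [fderiv_fun_sub (d3.inner ℝ d2) (d1.inner ℝ d4), sub_apply,
    fderiv_inner_apply ℝ d3 d2, fderiv_inner_apply ℝ d1 d4]
  ring

/-- Differentiation under the integral over the torus. -/
theorem hasDerivAt_integral_fundamentalSquare (a : ℝ) {g : ℝ × Plane → ℝ} (hg : ContDiff ℝ 1 g)
    (t₀ : ℝ) :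
    HasDerivAt (fun t => ∫ z in fundamentalSquare a, g (t, z))
      (∫ z in fundamentalSquare a, fderiv ℝ g (t₀, z) (1, 0)) t₀ := by
  have hc : Continuous fun p : ℝ × Plane => fderiv ℝ g p (1, 0) :=
    (hg.continuous_fderiv (by simp)).clm_apply continuous_const
  -- Compactness of a unit time interval times the closed square gives a constant dominating
  -- function.
  obtain ⟨C, hC⟩ := ((isCompact_closedBall t₀ 1).prod
    (isCompact_closedSquare a)).exists_bound_of_continuousOn hc.continuousOn
  refine (hasDerivAt_integral_of_dominated_loc_of_deriv_le (bound := fun _ => C)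
    (F' := fun t z => fderiv ℝ g (t, z) (1, 0)) (Metric.closedBall_mem_nhds t₀ one_pos)
    (Filter.Eventually.of_forall fun t => ?_) ?_ ?_ ?_ ?_ ?_).2
  · exact (hg.continuous.comp (by fun_prop)).aestronglyMeasurable
  · exact (hg.continuous.comp (by fun_prop : Continuous fun z : Plane =>
      (t₀, z))).integrableOn_fundamentalSquare a
  · exact (hc.comp (by fun_prop)).aestronglyMeasurable
  · filter_upwards [ae_restrict_mem (measurableSet_fundamentalSquare a)] with z hz t ht
    exact hC (t, z) ⟨ht, fundamentalSquare_subset_closedSquare a hz⟩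
  · exact continuous_const.integrableOn_fundamentalSquare a
  · refine Filter.Eventually.of_forall fun z t _ => ?_
    have h1 := ((hg.differentiable (by simp)) (t, z)).hasFDerivAt
    have h2 : HasDerivAt (fun s : ℝ => (s, z)) ((1 : ℝ), (0 : Plane)) t :=
      (hasDerivAt_id t).prodMk (hasDerivAt_const t z)
    exact h1.comp_hasDerivAt t h2

end Calculus

/-! ### First variation of the bienergy -/

section FirstVariation

open MeasureTheory Set

section Slice

variable {E : Type*} [NormedAddCommGroup E] [NormedSpace ℝ E]

/-- The Laplacian in the plane variable of a function of time and of a point of the plane. -/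
def spatialLaplacian (Ψ : ℝ × Plane → E) (p : ℝ × Plane) : E :=
  ∑ i, fderiv ℝ (fun q => fderiv ℝ Ψ q (0, stdVec i)) p (0, stdVec i)

theorem fderiv_slice {Ψ : ℝ × Plane → E} (hΨ : ContDiff ℝ ∞ Ψ) (t : ℝ) (z u : Plane) :
    fderiv ℝ (fun w => Ψ (t, w)) z u = fderiv ℝ Ψ (t, z) (0, u) := by
  have h1 := ((hΨ.differentiable (by simp)) (t, z)).hasFDerivAt
  have h2 := h1.comp z (hasFDerivAt_prodMk_right t z)
  have h3 := h2.fderiv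
  simp only [Function.comp_def] at h3
  rw [h3]
  simp

theorem laplacian_slice {Ψ : ℝ × Plane → E} (hΨ : ContDiff ℝ ∞ Ψ) (t : ℝ) (z : Plane) :
    laplacian (fun w => Ψ (t, w)) z = spatialLaplacian Ψ (t, z) := by
  simp only [laplacian, spatialLaplacian, fderiv_slice hΨ]
  exact Finset.sum_congr rfl fun i _ => fderiv_slice (contDiff_fderiv_apply_const hΨ _) t z _

theorem contDiff_spatialLaplacian {Ψ : ℝ × Plane → E} (hΨ : ContDiff ℝ ∞ Ψ) :
    ContDiff ℝ ∞ (spatialLaplacian Ψ) :=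
  ContDiff.sum fun _ _ => contDiff_fderiv_apply_const (contDiff_fderiv_apply_const hΨ _) _

/-- With `v = (1, 0)` this lets the time derivative pass through the Laplacian, by symmetry of
second derivatives. -/
theorem fderiv_spatialLaplacian {Ψ : ℝ × Plane → E} (hΨ : ContDiff ℝ ∞ Ψ) (p v : ℝ × Plane) :
    fderiv ℝ (spatialLaplacian Ψ) p v = spatialLaplacian (fun q => fderiv ℝ Ψ q v) p := by
  have h := fun i : Fin 2 => contDiff_fderiv_apply_const hΨ (0, stdVec i)
  have e : spatialLaplacian Ψ =
      fun q => ∑ i, fderiv ℝ (fun q => fderiv ℝ Ψ q (0, stdVec i)) q (0, stdVec i) := rfl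
  rw [e, fderiv_fun_sum fun i _ =>
    ((contDiff_fderiv_apply_const (h i) (0, stdVec i)).differentiable (by simp)) p]
  simp only [sum_apply, spatialLaplacian]
  refine Finset.sum_congr rfl fun i _ => ?_
  rw [fderiv_fderiv_apply_comm (h i)]
  simp only [fderiv_fderiv_apply_comm hΨ (0, stdVec i) v]

end Slice

variable {a : ℝ} {n : ℕ}

theorem norm_lift (φ : SquareTorus a → UnitSphere n) (z : Plane) : ‖lift φ z‖ = 1 := by
  simp [lift]

theorem lift_add_period (φ : SquareTorus a → UnitSphere n) (i : Fin 2) (z : Plane) :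
    lift φ (z + (2 * Real.pi * a) • stdVec i) = lift φ z := by
  have : (QuotientAddGroup.mk (z + (2 * Real.pi * a) • stdVec i) : SquareTorus a) =
      QuotientAddGroup.mk z := by
    rw [eq_comm, QuotientAddGroup.eq]
    refine ⟨Pi.single i 1, fun j => ?_⟩
    by_cases h : j = i
    · subst h; simp [stdVec]
    · simp [stdVec, h]
  simp only [lift, this]

theorem laplacian_add_period {E : Type*} [NormedAddCommGroup E] [NormedSpace ℝ E]
    {G : Plane → E} {c : Plane} (h : ∀ z, G (z + c) = G z) (z : Plane) :
    laplacian G (z + c) = laplacian G z := by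
  refine Finset.sum_congr rfl fun i _ => ?_
  rw [fderiv_add_period fun w => by rw [fderiv_add_period h]]

theorem laplacian_add_const_smul {E : Type*} [NormedAddCommGroup E] [NormedSpace ℝ E]
    {G F : Plane → E} (hG : ContDiff ℝ ∞ G) (hF : ContDiff ℝ ∞ F) (c : ℝ) (z : Plane) :
    laplacian (fun w => G w + c • F w) z = laplacian G z + c • laplacian F z := by
  have hfd : ∀ {A B : Plane → E}, ContDiff ℝ ∞ A → ContDiff ℝ ∞ B → ∀ w u,
      fderiv ℝ (fun w => A w + c • B w) w u = fderiv ℝ A w u + c • fderiv ℝ B w u := by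
    intro A B hA hB w u
    have dA := (hA.differentiable (by simp)) w
    have dB := (hB.differentiable (by simp)) w
    rw [fderiv_fun_add dA (dB.fun_const_smul c), fderiv_fun_const_smul dB]
    rfl
  simp only [laplacian, Finset.smul_sum, ← Finset.sum_add_distrib, hfd hG hF]
  exact Finset.sum_congr rfl fun i _ => hfd (contDiff_fderiv_apply_const hG _)
    (contDiff_fderiv_apply_const hF _) z _

theorem norm_tension_sq (φ : SquareTorus a → UnitSphere n) (z : Plane) :
    ‖tension φ z‖ ^ 2 =
      inner ℝ (laplacian (lift φ) z) (laplacian (lift φ) z) -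
        inner ℝ (laplacian (lift φ) z) (lift φ z) ^ 2 := by
  rw [tension_eq_laplacian_sub, ← real_inner_self_eq_norm_sq]
  simp only [inner_sub_left, inner_sub_right, inner_smul_left, inner_smul_right,
    real_inner_self_eq_norm_sq (lift φ z), norm_lift,
    real_inner_comm (laplacian (lift φ) z) (lift φ z)]
  simp
  ring

/-- A map of the torus into the sphere whose energy density is constant and whose lift `F`
satisfies `Δ²F + 2eΔF ∈ ℝ F` with `e = -⟨ΔF, F⟩` is biharmonic. -/
theorem isBiharmonicMap_of_laplacian (ha : 0 < a) {φ : SquareTorus a → UnitSphere n}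
    (hφ : IsSmoothMap φ) (e C : ℝ)
    (henergy : ∀ z, inner ℝ (laplacian (lift φ) z) (lift φ z) = -e)
    (hbilap : ∀ z, laplacian (laplacian (lift φ)) z + (2 * e) • laplacian (lift φ) z =
      C • lift φ z) :
    IsBiharmonicMap φ := by
  refine ⟨hφ, ?_⟩
  rintro Φ ⟨hΨ, rfl⟩
  set Ψ : ℝ × Plane → Ambient n := fun p => lift (Φ p.1) p.2 with hΨdef
  set F := lift (Φ 0) with hF
  have hF_smooth : ContDiff ℝ ∞ F := hφ
  -- The variation field; it is tangent to the sphere along `F` because `‖Ψ‖ = 1`.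
  set V : Plane → Ambient n := fun z => fderiv ℝ Ψ (0, z) (1, 0) with hVdef
  have hDΨ := contDiff_fderiv_apply_const hΨ ((1 : ℝ), (0 : Plane))
  have hV : ContDiff ℝ ∞ V := hDΨ.comp (contDiff_const.prodMk contDiff_id)
  have hLΨ := contDiff_spatialLaplacian hΨ
  have hlap : ∀ t z, laplacian (lift (Φ t)) z = spatialLaplacian Ψ (t, z) := fun t z =>
    laplacian_slice hΨ t z
  have hlapV : ∀ z, fderiv ℝ (spatialLaplacian Ψ) (0, z) (1, 0) = laplacian V z := fun z => by
    rw [fderiv_spatialLaplacian hΨ]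
    exact (laplacian_slice hDΨ 0 z).symm
  set g : ℝ × Plane → ℝ := fun p =>
    inner ℝ (spatialLaplacian Ψ p) (spatialLaplacian Ψ p) -
      inner ℝ (spatialLaplacian Ψ p) (Ψ p) ^ 2 with hg
  have hg_smooth : ContDiff ℝ ∞ g := (hLΨ.inner ℝ hLΨ).sub ((hLΨ.inner ℝ hΨ).pow 2)
  have hE : (fun t => bienergy (Φ t)) =
      fun t => (1 / 2) * ∫ z in fundamentalSquare a, g (t, z) := by
    ext t
    simp only [bienergy, norm_tension_sq, hlap, hg, hΨdef]
  have hVper : ∀ i z, V (z + (2 * Real.pi * a) • stdVec i) = V z := fun i z => by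
    have hper : ∀ p : ℝ × Plane, Ψ (p + (0, (2 * Real.pi * a) • stdVec i)) = Ψ p := fun p => by
      simp [hΨdef, lift_add_period]
    have : fderiv ℝ Ψ ((0, z) + (0, (2 * Real.pi * a) • stdVec i)) = fderiv ℝ Ψ (0, z) := by
      rw [← fderiv_comp_add_right]
      simp only [hper]
    simp only [hVdef, ← this, Prod.mk_add_mk, add_zero]
  have hVF : ∀ z, inner ℝ (V z) (F z) = 0 := fun z => by
    have hconst : (fun p => inner ℝ (Ψ p) (Ψ p)) = fun _ => (1 : ℝ) := by
      ext p; simp [hΨdef, norm_lift]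
    have hd := (hΨ.differentiable (by simp)) (0, z)
    have h := fderiv_inner_apply ℝ hd hd (1, 0)
    rw [hconst] at h
    have h' : inner ℝ (F z) (V z) + inner ℝ (V z) (F z) = 0 := by simpa using h.symm
    rw [real_inner_comm] at h'
    linarith
  have hG : ContDiff ℝ ∞ fun z => laplacian F z + e • F z :=
    (contDiff_laplacian hF_smooth).add (hF_smooth.const_smul e)
  have hFper : ∀ i z, F (z + (2 * Real.pi * a) • stdVec i) = F z := lift_add_period _
  have hlapG : ∀ z, laplacian (fun z => laplacian F z + e • F z) z =
      laplacian (laplacian F) z + e • laplacian F z :=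
    laplacian_add_const_smul (contDiff_laplacian hF_smooth) hF_smooth e
  -- The derivative of the bienergy density is put in the exact shape of Green's identity for `V`
  -- and `ΔF + eF`, so that its integral vanishes.
  have hderiv : ∀ z, fderiv ℝ g (0, z) (1, 0) =
      2 * (inner ℝ (laplacian V z) (laplacian F z + e • F z) -
        inner ℝ (V z) (laplacian (fun z => laplacian F z + e • F z) z)) := fun z => by
    have d1 := (hLΨ.differentiable (by simp)) (0, z)
    have d2 := (hΨ.differentiable (by simp)) (0, z)
    have hL0 : spatialLaplacian Ψ (0, z) = laplacian F z := (hlap 0 z).symm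
    have hpow := ((d1.inner ℝ d2).hasFDerivAt.pow 2).fderiv
    rw [hg, fderiv_fun_sub (d1.inner ℝ d1) ((d1.inner ℝ d2).fun_pow 2), sub_apply,
      fderiv_inner_apply ℝ d1 d1, hpow]
    simp only [smul_apply, fderiv_inner_apply ℝ d1 d2, hlapV, hL0]
    -- Pairing with the tangent field `V` kills the term `C • F` and leaves `⟨V, Δ²F⟩ = -2e⟨V, ΔF⟩`.
    have hb := congrArg (inner ℝ (V z)) (hbilap z)
    have hen := henergy z
    rw [inner_smul_right, hVF, mul_zero, inner_add_right, inner_smul_right] at hb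
    change _ - (2 • (inner ℝ (laplacian F z) (F z)) ^ (2 - 1)) •
      (inner ℝ (laplacian F z) (V z) + inner ℝ (laplacian V z) (F z)) = _
    rw [hen, hlapG, inner_add_right, inner_add_right, inner_smul_right, inner_smul_right,
      real_inner_comm (laplacian V z) (laplacian F z), real_inner_comm (V z) (laplacian F z)]
    simp
    linarith
  rw [hE]
  have key := (hasDerivAt_integral_fundamentalSquare a (hg_smooth.of_le (by simp)) 0).const_mul
    (1 / 2 : ℝ)
  simp only [hderiv, integral_const_mul] at key
  rw [integral_inner_laplacian_sub_eq_zero ha hV hG hVper fun i z => by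
    simp only [laplacian_add_period (hFper i), hFper]] at key
  simpa using key

end FirstVariation

/-! ### Immersions by plane waves -/

section PlaneWaves

open Real

/-- The character `z ↦ exp(i⟨g, z⟩)` of the plane. -/
def planeChar (g : Plane) : Multiplicative Plane →* ℂ where
  toFun z := Complex.exp ((inner ℝ g z.toAdd : ℝ) * Complex.I)
  map_one' := by simp
  map_mul' x y := by simp [inner_add_right, add_mul, Complex.exp_add]

/-- At `π(g - h)/‖g - h‖²` the characters of `g ≠ h` differ by the factor `exp(iπ) = -1`. -/
theorem planeChar_injective : Function.Injective planeChar := by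
  intro g h hgh
  by_contra hne
  have hd : ‖g - h‖ ^ 2 ≠ 0 := by simpa [sub_eq_zero] using hne
  have h1 := DFunLike.congr_fun hgh (Multiplicative.ofAdd ((π / ‖g - h‖ ^ 2) • (g - h)))
  have h2 : inner ℝ g ((π / ‖g - h‖ ^ 2) • (g - h)) =
      inner ℝ h ((π / ‖g - h‖ ^ 2) • (g - h)) + π := by
    rw [← sub_eq_iff_eq_add', ← inner_sub_left, inner_smul_right, real_inner_self_eq_norm_sq,
      div_mul_cancel₀ _ hd]
  simp only [planeChar, MonoidHom.coe_mk, OneHom.coe_mk, toAdd_ofAdd, h2, Complex.ofReal_add,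
    add_mul, Complex.exp_add, Complex.exp_pi_mul_I, mul_neg_one] at h1
  exact Complex.exp_ne_zero _ (self_eq_neg.1 h1.symm)

variable {ι : Type*} {n : ℕ}

/-- The map of the plane into `ℝ^{n+1}` which, in the pair of coordinates that `e` labels by `k`,
is the plane wave `A k • (cos(⟨f k, z⟩ + α), sin(⟨f k, z⟩ + α))`. -/
def waveMap (e : Fin (n + 1) ≃ ι × Bool) (f : ι → Plane) (A : ι → ℝ) (α : ℝ) (z : Plane) :
    Ambient n :=
  WithLp.toLp 2 fun j =>
    A (e j).1 * cos (inner ℝ (f (e j).1) z + α - if (e j).2 then π / 2 else 0)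

section

variable (e : Fin (n + 1) ≃ ι × Bool) (f : ι → Plane)

/-- The two coordinates of a pair combine through `cos(θ - θ')`, so the dependence on `z` cancels.
All inner products needed later are therefore constant, and phases a quarter turn apart give
orthogonal vectors. -/
theorem inner_waveMap [Fintype ι] (A B : ι → ℝ) (α β : ℝ) (z : Plane) :
    inner ℝ (waveMap e f A α z) (waveMap e f B β z) = (∑ k, A k * B k) * cos (α - β) := by
  rw [PiLp.inner_apply, ← e.symm.sum_comp, Fintype.sum_prod_type, Finset.sum_mul]
  refine Finset.sum_congr rfl fun k _ => ?_
  simp only [waveMap, Fintype.sum_bool, Equiv.apply_symm_apply, RCLike.inner_apply, conj_trivial,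
    if_true, Bool.false_eq_true, if_false, sub_zero, cos_sub_pi_div_two]
  rw [show α - β = (inner ℝ (f k) z + α) - (inner ℝ (f k) z + β) by ring,
    cos_sub (inner ℝ (f k) z + α)]
  ring

theorem contDiff_waveMap (A : ι → ℝ) (α : ℝ) : ContDiff ℝ ∞ (waveMap e f A α) := by
  rw [contDiff_euclidean]
  intro j
  have h : ContDiff ℝ ∞ fun z : Plane => inner ℝ (f (e j).1) z := contDiff_const.inner ℝ contDiff_id
  exact contDiff_const.mul ((h.add contDiff_const).sub contDiff_const).cos

/-- The phase `α` exists for this formula: differentiation stays within the family, multiplying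
amplitudes and advancing the phase by a quarter turn. -/
theorem fderiv_waveMap (A : ι → ℝ) (α : ℝ) (z u : Plane) :
    fderiv ℝ (waveMap e f A α) z u =
      waveMap e f (fun k => A k * inner ℝ (f k) u) (α + π / 2) z := by
  have hd := ((contDiff_waveMap e f A α).differentiable (by simp)) z
  ext j
  have h1 : HasFDerivAt (fun w => waveMap e f A α w j)
      ((EuclideanSpace.proj j : Ambient n →L[ℝ] ℝ) ∘L fderiv ℝ (waveMap e f A α) z) z :=
    (EuclideanSpace.proj j : Ambient n →L[ℝ] ℝ).hasFDerivAt.comp z hd.hasFDerivAt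
  have h2 : HasFDerivAt (fun w => waveMap e f A α w j) _ z :=
    ((((((innerSL ℝ (f (e j).1)).hasFDerivAt (x := z)).add_const α).sub_const
      (if (e j).2 then π / 2 else 0)).cos).const_mul (A (e j).1))
  have h3 := DFunLike.congr_fun (h1.unique h2) u
  refine Eq.trans h3 ?_
  simp only [waveMap, smul_apply, innerSL_apply_apply, smul_eq_mul]
  rw [show inner ℝ (f (e j).1) z + (α + π / 2) - (if (e j).2 then π / 2 else 0) =
    inner ℝ (f (e j).1) z + α - (if (e j).2 then π / 2 else 0) + π / 2 by ring, cos_add_pi_div_two]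
  ring

theorem laplacian_waveMap (A : ι → ℝ) (α : ℝ) :
    laplacian (waveMap e f A α) = waveMap e f (fun k => -(‖f k‖ ^ 2) * A k) α := by
  ext z j
  simp only [laplacian, fderiv_waveMap]
  simp only [waveMap, EuclideanSpace.norm_sq_eq, Real.norm_eq_abs, sq_abs, Fin.sum_univ_two, stdVec,
    EuclideanSpace.inner_single_right, PiLp.add_apply]
  rw [show inner ℝ (f (e j).1) z + (α + π / 2 + π / 2) - (if (e j).2 then π / 2 else 0) =
    inner ℝ (f (e j).1) z + α - (if (e j).2 then π / 2 else 0) + π by ring, cos_add_pi]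
  simp
  ring

theorem waveMap_add_smul (A B : ι → ℝ) (c α : ℝ) (z : Plane) :
    waveMap e f A α z + c • waveMap e f B α z = waveMap e f (fun k => A k + c * B k) α z := by
  ext j
  simp [waveMap]
  ring

theorem waveMap_add_period {a : ℝ} (hf : ∀ k i, ∃ l : ℤ, a * f k i = l) (A : ι → ℝ) (α : ℝ)
    (z : Plane) {c : Plane} (hc : c ∈ squareLattice a) :
    waveMap e f A α (z + c) = waveMap e f A α z := by
  obtain ⟨m, hm⟩ := hc
  ext j
  obtain ⟨l₀, h₀⟩ := hf (e j).1 0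
  obtain ⟨l₁, h₁⟩ := hf (e j).1 1
  have : inner ℝ (f (e j).1) c = ((l₀ * m 0 + l₁ * m 1 : ℤ) : ℝ) * (2 * π) := by
    simp only [PiLp.inner_apply, Fin.sum_univ_two, hm, RCLike.inner_apply, conj_trivial]
    push_cast
    rw [← h₀, ← h₁]
    ring
  simp only [waveMap, inner_add_right, this]
  congr 1
  rw [← cos_add_int_mul_two_pi (inner ℝ (f (e j).1) z + α - _) (l₀ * m 0 + l₁ * m 1)]
  congr 1
  ring

/-- A linear relation among the coordinates is one among the characters of the `±f k`; these are
distinct, hence independent. -/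
theorem eq_zero_of_inner_waveMap_eq_zero [Fintype ι] (hinj : Function.Injective f)
    (hneg : ∀ k l, f k ≠ -f l) {A : ι → ℝ} (hA : ∀ k, A k ≠ 0) {c : Ambient n}
    (hc : ∀ z, inner ℝ c (waveMap e f A 0 z) = 0) : c = 0 := by
  set g : ι × Bool → Plane := fun p => if p.2 then f p.1 else -f p.1 with hg
  have hginj : Function.Injective g := by
    rintro ⟨k, b⟩ ⟨l, b'⟩ h
    rcases b <;> rcases b' <;> simp only [hg, if_true, if_false, Bool.false_eq_true] at h
    · rw [hinj (neg_injective h)]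
    · exact absurd h.symm (hneg _ _)
    · exact absurd h (hneg _ _)
    · rw [hinj h]
  have hli := (linearIndependent_monoidHom (Multiplicative Plane) ℂ).comp (fun p => planeChar (g p))
    (planeChar_injective.comp hginj)
  set x : ι → ℝ := fun k => c (e.symm (k, false))
  set y : ι → ℝ := fun k => c (e.symm (k, true))
  -- The coefficients come from `2(x cos θ + y sin θ) = (x - iy)exp(iθ) + (x + iy)exp(-iθ)`.
  have hcoef := Fintype.linearIndependent_iff.1 hli
    (fun p => (A p.1 : ℂ) * (x p.1 + (if p.2 then -1 else 1) * y p.1 * Complex.I)) (by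
      ext z
      have h := hc z.toAdd
      rw [PiLp.inner_apply, ← e.symm.sum_comp, Fintype.sum_prod_type] at h
      have h' := congrArg (fun t : ℝ => 2 * (t : ℂ)) h
      simp only [waveMap, Fintype.sum_bool, Equiv.apply_symm_apply, RCLike.inner_apply,
        conj_trivial, if_true, Bool.false_eq_true, if_false, sub_zero, add_zero,
        cos_sub_pi_div_two, Complex.ofReal_sum, Complex.ofReal_zero, mul_zero, Finset.mul_sum,
        Complex.ofReal_add, Complex.ofReal_mul, Complex.ofReal_cos, Complex.ofReal_sin] at h'
      rw [Finset.sum_apply, Fintype.sum_prod_type, Pi.zero_apply, ← h']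
      refine Finset.sum_congr rfl fun k _ => ?_
      simp only [Fintype.sum_bool, Function.comp_apply, Pi.smul_apply, smul_eq_mul, planeChar,
        MonoidHom.coe_mk, OneHom.coe_mk, hg, if_true, Bool.false_eq_true, if_false, inner_neg_left,
        Complex.ofReal_neg, Complex.exp_mul_I, Complex.cos_neg, Complex.sin_neg]
      linear_combination (-2 * (A k : ℂ) * y k * Complex.sin (inner ℝ (f k) z.toAdd : ℝ)) *
        Complex.I_sq)
  have hxy : ∀ k, x k = 0 ∧ y k = 0 := fun k => by
    have h := hcoef (k, false)
    simp only [Bool.false_eq_true, if_false, one_mul, mul_eq_zero, Complex.ofReal_eq_zero, hA k,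
      false_or] at h
    exact ⟨by simpa using congrArg Complex.re h, by simpa using congrArg Complex.im h⟩
  ext j
  obtain ⟨⟨k, b⟩, rfl⟩ := e.symm.surjective j
  rcases b
  · exact (hxy k).1
  · exact (hxy k).2

end

/-- A finite system of weighted frequencies in the dual of the square lattice gives a full
isometric immersion of the square torus as soon as it is isotropic; the immersion is
proper-biharmonic with constant mean curvature if the squared norms of the frequencies are
roots of a polynomial `X² - 4X + C` and are not all equal to `2`. -/
theorem exists_properBiharmonic_of_frequencies [Fintype ι] {a : ℝ} (ha : 0 < a)
    (e : Fin (n + 1) ≃ ι × Bool) (f : ι → Plane) (w : ι → ℝ) (hw : ∀ k, 0 < w k)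
    (hint : ∀ k i, ∃ l : ℤ, a * f k i = l) (hinj : Function.Injective f)
    (hneg : ∀ k l, f k ≠ -f l) (hsum : ∑ k, w k = 1)
    (hiso : ∀ u v, ∑ k, w k * (inner ℝ (f k) u * inner ℝ (f k) v) = inner ℝ u v)
    (C : ℝ) (hC : ∀ k, (‖f k‖ ^ 2) ^ 2 - 4 * ‖f k‖ ^ 2 = C) (hne : ∃ k, ‖f k‖ ^ 2 ≠ 2) :
    ∃ φ : SquareTorus a → UnitSphere n,
      IsRiemannianImmersion φ ∧ IsFull φ ∧ IsCMC φ ∧ IsProperBiharmonic φ := by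
  set A : ι → ℝ := fun k => √(w k) with hAdef
  have hA : ∀ k, A k ≠ 0 := fun k => (sqrt_pos.2 (hw k)).ne'
  have hAA : ∀ k, A k * A k = w k := fun k => mul_self_sqrt (hw k).le
  have hsphere : ∀ z, waveMap e f A 0 z ∈ Metric.sphere (0 : Ambient n) 1 := fun z => by
    have h := inner_waveMap e f A A 0 0 z
    simp only [hAA, hsum, sub_self, cos_zero, mul_one, real_inner_self_eq_norm_sq] at h
    rw [mem_sphere_zero_iff_norm]
    exact (pow_eq_one_iff_of_nonneg (norm_nonneg _) two_ne_zero).1 h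
  let φ : SquareTorus a → UnitSphere n := fun x =>
    Quotient.liftOn' x (fun z => (⟨waveMap e f A 0 z, hsphere z⟩ : UnitSphere n)) (by
      intro z z' h
      rw [QuotientAddGroup.leftRel_apply] at h
      have := waveMap_add_period e f hint A 0 z h
      rw [add_neg_cancel_left] at this
      exact Subtype.ext this.symm)
  have hlift : lift φ = waveMap e f A 0 := rfl
  have hsmooth : IsSmoothMap φ := contDiff_waveMap e f A 0
  have htrace : ∑ k, w k * ‖f k‖ ^ 2 = 2 := by
    have h0 := hiso (stdVec 0) (stdVec 0)
    have h1 := hiso (stdVec 1) (stdVec 1)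
    have : ∑ k, w k * ‖f k‖ ^ 2 = inner ℝ (stdVec 0) (stdVec 0) + inner ℝ (stdVec 1) (stdVec 1) := by
      rw [← h0, ← h1, ← Finset.sum_add_distrib]
      refine Finset.sum_congr rfl fun k _ => ?_
      simp only [EuclideanSpace.norm_sq_eq, Real.norm_eq_abs, sq_abs, Fin.sum_univ_two, stdVec,
        EuclideanSpace.inner_single_right]
      simp
      ring
    rw [this]
    simp [stdVec]
    norm_num
  have henergy : ∀ z, inner ℝ (laplacian (lift φ) z) (lift φ z) = -2 := fun z => by
    rw [hlift, laplacian_waveMap, inner_waveMap, sub_self, cos_zero, mul_one, ← htrace,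
      ← Finset.sum_neg_distrib]
    exact Finset.sum_congr rfl fun k _ => by rw [← hAA k]; ring
  have htension : ∀ z, tension φ z = waveMap e f (fun k => (2 - ‖f k‖ ^ 2) * A k) 0 z := fun z => by
    rw [tension_eq_laplacian_sub, henergy, neg_smul, sub_neg_eq_add, hlift, laplacian_waveMap,
      waveMap_add_smul]
    congr 1
    ext k
    ring
  have hnorm : ∀ z, ‖tension φ z‖ ^ 2 = ∑ k, (2 - ‖f k‖ ^ 2) ^ 2 * w k := fun z => by
    rw [htension, ← real_inner_self_eq_norm_sq, inner_waveMap, sub_self, cos_zero, mul_one]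
    exact Finset.sum_congr rfl fun k _ => by rw [← hAA k]; ring
  have hnormal : ∀ z, tension φ z ∈ (tangentPlane φ z)ᗮ := fun z => by
    rw [Submodule.mem_orthogonal]
    rintro _ ⟨u, rfl⟩
    change inner ℝ (fderiv ℝ (lift φ) z u) _ = 0
    -- The phases are `π/2` and `0`, and `cos (π/2) = 0`.
    rw [htension, hlift, fderiv_waveMap, inner_waveMap]
    simp
  refine ⟨φ, ⟨hsmooth, fun z u v => ?_⟩, fun W hW => ?_, ?_, ⟨?_, fun hharm => ?_⟩⟩
  · rw [hlift, fderiv_waveMap, fderiv_waveMap, inner_waveMap, sub_self, cos_zero, mul_one, ← hiso]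
    exact Finset.sum_congr rfl fun k _ => by rw [← hAA k]; ring
  · rw [← Submodule.orthogonal_eq_bot_iff, Submodule.eq_bot_iff]
    intro c hc
    refine eq_zero_of_inner_waveMap_eq_zero e f hinj hneg hA fun z => ?_
    rw [real_inner_comm]
    exact (Submodule.mem_orthogonal W c).1 hc _ (hW (QuotientAddGroup.mk z))
  · refine ⟨1 / 2 * √(∑ k, (2 - ‖f k‖ ^ 2) ^ 2 * w k), fun z => ?_⟩
    -- The tension field is already normal, so projecting to the normal space changes nothing.
    have : meanCurvatureVector φ z = (1 / 2 : ℝ) • tension φ z := by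
      simp only [meanCurvatureVector, secondFundamentalForm, ← map_sum]
      congr 1
      exact Submodule.starProjection_eq_self_iff.2 (hnormal z)
    rw [this, norm_smul, ← hnorm z, sqrt_sq (norm_nonneg _)]
    norm_num
  · refine isBiharmonicMap_of_laplacian ha hsmooth 2 C henergy fun z => ?_
    simp only [hlift, laplacian_waveMap, waveMap_add_smul]
    ext j
    simp only [waveMap, PiLp.smul_apply, smul_eq_mul, ← hC (e j).1]
    ring
  · obtain ⟨k, hk⟩ := hne
    have h := hnorm 0
    rw [hharm, norm_zero, zero_pow two_ne_zero] at h
    have h0 := (Finset.sum_eq_zero_iff_of_nonneg fun k _ =>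
      mul_nonneg (sq_nonneg _) (hw k).le).1 h.symm k (Finset.mem_univ k)
    rcases mul_eq_zero.1 h0 with h0 | h0
    · exact hk (by linarith [pow_eq_zero_iff two_ne_zero |>.1 h0])
    · exact (hw k).ne' h0

end PlaneWaves

/-! ### Rational isotropic frequency systems -/

section Frequencies

/-- There are arbitrarily many rational points on the right half of the unit circle, pairwise
distinct and symmetric with respect to the first axis. -/
theorem exists_rational_points (M : ℕ) : ∃ p q : Fin M → ℚ,
    (∀ k, p k ^ 2 + q k ^ 2 = 1) ∧ (∀ k, 0 < p k) ∧ Function.Injective q ∧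
      ∑ k, p k * q k = 0 := by
  -- Equally spaced parameters, symmetric about 0 and inside `(-1, 1)`, for the rational
  -- parametrisation of the circle; `Fin.rev` changes their sign.
  set t : Fin M → ℚ := fun k => (2 * (k : ℚ) + 1 - M) / (2 * M) with ht
  have hM : ∀ _ : Fin M, (0 : ℚ) < M := fun k => by exact_mod_cast k.pos
  have hlt : ∀ k, t k < 1 := fun k => by
    have h : (k : ℚ) + 1 ≤ M := by exact_mod_cast k.isLt
    have := hM k
    rw [ht, div_lt_one (by positivity)]
    linarith
  have hgt : ∀ k, -1 < t k := fun k => by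
    have := hM k
    rw [ht, lt_div_iff₀ (by positivity)]
    have : (0 : ℚ) ≤ k := by positivity
    linarith
  have hrev : ∀ k, t (Fin.rev k) = -t k := fun k => by
    have h : ((Fin.rev k : ℕ) : ℚ) = M - 1 - k := by
      rw [Fin.val_rev, Nat.cast_sub k.isLt]
      push_cast
      ring
    simp only [ht, h]
    ring
  have hinj : Function.Injective t := fun k l h => by
    have := hM k
    simp only [ht] at h
    rw [div_left_inj' (by positivity)] at h
    have h' : (k : ℚ) = l := by linarith
    exact Fin.ext (by exact_mod_cast h')
  have hpos : ∀ k, 0 < 1 + t k ^ 2 := fun k => by positivity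
  refine ⟨fun k => (1 - t k ^ 2) / (1 + t k ^ 2), fun k => 2 * t k / (1 + t k ^ 2), fun k => ?_,
    fun k => ?_, fun k l h => ?_, ?_⟩
  · have := (hpos k).ne'
    field_simp
    ring
  · exact div_pos (by nlinarith [hlt k, hgt k]) (hpos k)
  · have h1 : 2 * t k / (1 + t k ^ 2) = 2 * t l / (1 + t l ^ 2) := h
    rw [div_eq_div_iff (hpos k).ne' (hpos l).ne'] at h1
    have h2 : (t k - t l) * (1 - t k * t l) = 0 := by linarith
    rcases mul_eq_zero.1 h2 with h3 | h3
    · exact hinj (sub_eq_zero.1 h3)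
    · have h4 : |t k * t l| < 1 := by
        rw [abs_mul]
        exact mul_lt_one_of_nonneg_of_lt_one_left (abs_nonneg _) (abs_lt.2 ⟨hgt k, hlt k⟩)
          (abs_lt.2 ⟨hgt l, hlt l⟩).le
      linarith [(abs_lt.1 h4).2]
  -- The summand is odd in `t`, so reversing the index negates the sum.
  · have h := Equiv.sum_comp Fin.revPerm fun k =>
      (1 - t k ^ 2) / (1 + t k ^ 2) * (2 * t k / (1 + t k ^ 2))
    simp only [Fin.revPerm_apply, hrev, neg_sq, mul_neg, neg_div, Finset.sum_neg_distrib] at h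
    linarith

theorem exists_common_denominator {κ : Type*} [Fintype κ] (r : κ → ℚ) :
    ∃ D : ℕ, 0 < D ∧ ∀ i, ∃ l : ℤ, (D : ℚ) * r i = l := by
  refine ⟨∏ i, (r i).den, Finset.prod_pos fun i _ => (r i).den_pos, fun i => ?_⟩
  obtain ⟨c, hc⟩ := Finset.dvd_prod_of_mem (fun i => (r i).den) (Finset.mem_univ i)
  refine ⟨c * (r i).num, ?_⟩
  rw [hc]
  push_cast
  rw [← Rat.den_mul_eq_num]
  ring

/-- Isotropic systems of rational frequencies with two distinct lengths, each carrying half of the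
total weight. -/
theorem exists_rational_frequencies {M : ℕ} (hM : 0 < M) :
    ∃ (P Q w : Fin M ⊕ Bool → ℚ) (N : ℚ), 1 < N ∧ (∀ k, 0 < w k) ∧ ∑ k, w k = 1 ∧
      (∀ k, P (.inl k) ^ 2 + Q (.inl k) ^ 2 = 1) ∧ (∀ b, P (.inr b) ^ 2 + Q (.inr b) ^ 2 = N) ∧
      ∑ k, w k * P k ^ 2 = (1 + N) / 4 ∧ ∑ k, w k * Q k ^ 2 = (1 + N) / 4 ∧
      ∑ k, w k * (P k * Q k) = 0 ∧ (∀ k l, P k = P l → Q k = Q l → k = l) ∧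
      ∀ k l, P k = -P l → Q k ≠ -Q l := by
  obtain ⟨p, q, hpq, hp, hq, hsum⟩ := exists_rational_points M
  have hM' : (0 : ℚ) < M := by exact_mod_cast hM
  set v : ℚ := (∑ k, (p k ^ 2 - q k ^ 2)) / M with hv
  have hv1 : v ≤ 1 := by
    rw [hv, div_le_one hM']
    calc ∑ k, (p k ^ 2 - q k ^ 2) ≤ ∑ _k : Fin M, (1 : ℚ) :=
          Finset.sum_le_sum fun k _ => by linarith [hpq k, sq_nonneg (q k)]
      _ = M := by simp
  have hv2 : -1 ≤ v := by
    rw [hv, le_div_iff₀ hM']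
    calc -1 * (M : ℚ) = ∑ _k : Fin M, (-1 : ℚ) := by simp
      _ ≤ _ := Finset.sum_le_sum fun k _ => by linarith [hpq k, sq_nonneg (p k)]
  have hsum1 : ∑ k, (p k ^ 2 + q k ^ 2) = M := by simp [hpq]
  have hsum2 : ∑ k, (p k ^ 2 - q k ^ 2) = v * M := by rw [hv, div_mul_cancel₀ _ hM'.ne']
  rw [Finset.sum_add_distrib] at hsum1
  rw [Finset.sum_sub_distrib] at hsum2
  -- The mirror pair `(x, ±y)` must satisfy `y² - x² = v` to balance the first circle. Factoring `v
  -- = 3 · (v/3)` as `(y - x)(y + x)` solves this rationally; since `|v| ≤ 1`, it also gives `x < 0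
  -- < y` and `x² + y² ≥ 9/2`.
  set x : ℚ := (v / 3 - 3) / 2 with hx
  set y : ℚ := (v / 3 + 3) / 2 with hy
  have hx0 : x < 0 := by rw [hx]; linarith
  have hy0 : 0 < y := by rw [hy]; linarith
  have hxy : y ^ 2 - x ^ 2 = v := by rw [hx, hy]; ring
  have hN : 1 < x ^ 2 + y ^ 2 := by
    have : x ^ 2 + y ^ 2 = (v ^ 2 / 9 + 9) / 2 := by rw [hx, hy]; ring
    nlinarith [sq_nonneg v]
  refine ⟨Sum.elim p fun _ => x, Sum.elim q fun b => if b then y else -y,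
    Sum.elim (fun _ => 1 / (2 * M)) fun _ => 1 / 4, x ^ 2 + y ^ 2, hN, ?_, ?_, hpq, ?_, ?_, ?_, ?_,
    ?_, ?_⟩
  · rintro (k | b)
    · simp only [Sum.elim_inl]; positivity
    · simp
  · simp only [Fintype.sum_sum_type, Sum.elim_inl, Sum.elim_inr, Finset.sum_const,
      Finset.card_univ, Fintype.card_fin, nsmul_eq_mul]
    field_simp
    norm_num
  · rintro (_ | _) <;> simp
  · simp only [Fintype.sum_sum_type, Sum.elim_inl, Sum.elim_inr, Fintype.sum_bool, ← Finset.mul_sum]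
    have : ∑ k, p k ^ 2 = (1 + v) / 2 * M := by linarith
    rw [this]
    field_simp
    linarith
  · simp only [Fintype.sum_sum_type, Sum.elim_inl, Sum.elim_inr, Fintype.sum_bool, ← Finset.mul_sum,
      if_true, Bool.false_eq_true, if_false]
    have : ∑ k, q k ^ 2 = (1 - v) / 2 * M := by linarith
    rw [this]
    field_simp
    linarith
  · simp [Fintype.sum_sum_type, ← Finset.mul_sum, hsum]
  · rintro (k | b) (l | b') h1 h2
    · rw [hq h2]
    -- Points on different circles cannot coincide, since `N ≠ 1`.
    · have := hpq k
      simp only [Sum.elim_inl, Sum.elim_inr] at h1 h2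
      rw [h1, h2] at this
      rcases b' <;> simp at this <;> linarith
    · have := hpq l
      simp only [Sum.elim_inl, Sum.elim_inr] at h1 h2
      rw [← h1, ← h2] at this
      rcases b <;> simp at this <;> linarith
    · rcases b <;> rcases b' <;> simp at h2 ⊢ <;> linarith
  · rintro (k | b) (l | b') h1 h2
    · simp only [Sum.elim_inl] at h1
      linarith [hp k, hp l]
    · have := hpq k
      simp only [Sum.elim_inl, Sum.elim_inr] at h1 h2
      rw [h1, h2] at this
      rcases b' <;> simp at this <;> linarith
    · have := hpq l
      simp only [Sum.elim_inl, Sum.elim_inr] at h1 h2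
      rw [← neg_sq, ← h1, ← neg_sq (q l), ← h2] at this
      rcases b <;> simp at this <;> linarith
    · simp only [Sum.elim_inr] at h1
      linarith

end Frequencies

end SquareTorusImmersion

/-! ### Rescaling and conclusion -/

open SquareTorusImmersion

theorem mainTheorem3 (n : ℕ) (hodd : Odd n) (hn : 5 ≤ n) :
    ∃ a : ℝ, 0 < a ∧
      ∃ φ : SquareTorusImmersion.SquareTorus a → SquareTorusImmersion.UnitSphere n,
        SquareTorusImmersion.IsRiemannianImmersion φ ∧
        SquareTorusImmersion.IsFull φ ∧
        SquareTorusImmersion.IsCMC φ ∧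
        SquareTorusImmersion.IsProperBiharmonic φ := by
  obtain ⟨r, hr⟩ := hodd
  obtain ⟨P, Q, w, N, hN, hw, hw1, hP1, hPN, hPP, hQQ, hPQ, hinj, hneg⟩ :=
    exists_rational_frequencies (M := r - 1) (by omega)
  obtain ⟨D, hD, hDint⟩ := exists_common_denominator (Sum.elim P Q)
  -- With `n = 2r + 1`, the `r - 1` points and the mirror pair account for `2(r + 1) = n + 1`
  -- coordinates; `n ≥ 5` makes `r - 1` positive.
  have hcard : Fintype.card (Fin (n + 1)) = Fintype.card ((Fin (r - 1) ⊕ Bool) × Bool) := by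
    simp
    omega
  have hN' : (1 : ℝ) < N := by exact_mod_cast hN
  -- Dividing by `s` turns the common second moment `(1 + N)/4` into 1.
  set s : ℝ := √((1 + N) / 4) with hs
  have hs0 : 0 < s := Real.sqrt_pos.2 (by linarith)
  have hs2 : s ^ 2 = (1 + N) / 4 := Real.sq_sqrt (by linarith)
  set f : Fin (r - 1) ⊕ Bool → Plane := fun k => !₂[(P k : ℝ) / s, (Q k : ℝ) / s] with hf
  have hnorm : ∀ k, ‖f k‖ ^ 2 = ((P k : ℝ) ^ 2 + (Q k : ℝ) ^ 2) / s ^ 2 := fun k => by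
    simp [hf, EuclideanSpace.norm_sq_eq, div_pow, add_div]
  have hlen1 : ∀ k, ‖f (.inl k)‖ ^ 2 = 4 / (1 + N) := fun k => by
    have h : (P (.inl k) : ℝ) ^ 2 + (Q (.inl k) : ℝ) ^ 2 = 1 := by exact_mod_cast hP1 k
    rw [hnorm, h, hs2, one_div_div]
  have hlenN : ∀ b, ‖f (.inr b)‖ ^ 2 = 4 * N / (1 + N) := fun b => by
    have h : (P (.inr b) : ℝ) ^ 2 + (Q (.inr b) : ℝ) ^ 2 = N := by exact_mod_cast hPN b
    rw [hnorm, h, hs2]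
    field_simp
  -- The factor `s` in `a = D * s` cancels the rescaling and `D` clears denominators. The squared
  -- lengths `4/(1 + N)` and `4N/(1 + N)` have sum 4 and product `16N/(1 + N)²`, whence the
  -- constant.
  refine ⟨D * s, by positivity, exists_properBiharmonic_of_frequencies (by positivity)
    (Fintype.equivOfCardEq hcard) f (fun k => w k) (fun k => by exact_mod_cast hw k) ?_ ?_ ?_
    (by exact_mod_cast hw1) ?_ (-(16 * N / (1 + N) ^ 2)) ?_ ⟨.inr true, ?_⟩⟩
  · intro k i
    fin_cases i
    · obtain ⟨l, hl⟩ := hDint (.inl k)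
      have hl' : (D : ℝ) * (P k : ℝ) = l := by exact_mod_cast hl
      refine ⟨l, ?_⟩
      simp only [hf, ← hl']
      simp
      field_simp
    · obtain ⟨l, hl⟩ := hDint (.inr k)
      have hl' : (D : ℝ) * (Q k : ℝ) = l := by exact_mod_cast hl
      refine ⟨l, ?_⟩
      simp only [hf, ← hl']
      simp
      field_simp
  · intro k l h
    have h0 := congrArg (fun z : Plane => z 0) h
    have h1 := congrArg (fun z : Plane => z 1) h
    simp [hf, div_left_inj' hs0.ne'] at h0 h1
    exact hinj k l h0 h1
  · intro k l h
    have h0 := congrArg (fun z : Plane => z 0) h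
    have h1 := congrArg (fun z : Plane => z 1) h
    simp [hf, ← neg_div, div_left_inj' hs0.ne'] at h0 h1
    exact hneg k l (by exact_mod_cast h0) (by exact_mod_cast h1)
  · intro u v
    have hPP' : ∑ k, (w k : ℝ) * (P k : ℝ) ^ 2 = s ^ 2 := by rw [hs2]; exact_mod_cast hPP
    have hQQ' : ∑ k, (w k : ℝ) * (Q k : ℝ) ^ 2 = s ^ 2 := by rw [hs2]; exact_mod_cast hQQ
    have hPQ' : ∑ k, (w k : ℝ) * ((P k : ℝ) * Q k) = 0 := by exact_mod_cast hPQ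
    calc
      _ = (∑ k, (w k : ℝ) * (P k : ℝ) ^ 2) * (u 0 * v 0 / s ^ 2) +
          (∑ k, (w k : ℝ) * (Q k : ℝ) ^ 2) * (u 1 * v 1 / s ^ 2) +
          (∑ k, (w k : ℝ) * ((P k : ℝ) * Q k)) * ((u 0 * v 1 + u 1 * v 0) / s ^ 2) := by
        simp only [Finset.sum_mul, ← Finset.sum_add_distrib]
        refine Finset.sum_congr rfl fun k _ => ?_
        simp [hf, PiLp.inner_apply, Fin.sum_univ_two]
        field_simp
        ring
      _ = inner ℝ u v := by
        rw [hPP', hQQ', hPQ']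
        simp only [PiLp.inner_apply, Fin.sum_univ_two, RCLike.inner_apply, conj_trivial]
        field_simp
        ring
  · rintro (k | b)
    · rw [hlen1]
      field_simp
      ring
    · rw [hlenN]
      field_simp
      ring
  · rw [hlenN, Ne, div_eq_iff (by linarith)]
    intro h
    linarith

end
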